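/- Notation. For a finite binary sequence $s\in 2^{<\omega}$ let $[s]=\{x\in 2^\omega : s\subseteq x\}$, and let $\mathbf{Lb}$ be the Lebesgue (product) measure on $2^\omega$. For $n<\omega$ let $\Omega_n$ be the set of finite $a\subseteq 2^{<\omega}$ with $\mathbf{Lb}\big(\bigcup_{s\in a}[s]\big)\le 2^{-n}$, let $\Omega=\prod_{n<\omega}\Omega_n$, and for $y\in\Omega$ let \[N^*_y=\bigcup_{n<\omega}\ \bigcap_{m\ge n}\ \bigcup_{s\in y(m)}[s],\] an $F_\sigma$ null subset of $2^\omega$. Let $\mathbf{Ue}=\langle 2^\omega,\Omega,\sqsubset^*\rangle$, where $x\sqsubset^* y$ iff $x\in N^*_y$. A complete Boolean algebra $\mathbb{B}$ (regarded as a forcing notion) is $\mathbf{Ue}$-good if for every $\mathbb{B}$-name $\dot y$ for a member of $\Omega$ there is a non-empty countable $H\subseteq\Omega$ in the ground model such that, for every $x\in 2^\omega$ in the ground model, if $x\notin N^*_y$ for all $y\in H$, then $\Vdash_{\mathbb{B}} x\notin N^*_{\dot y}$. Statement. Let $\mathbb{B}$ be a complete Boolean algebra with a strictly positive $\sigma$-additive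 measure, that is, a function $\mu:\mathbb{B}\to[0,1]$ such that $\mu(\mathbf 1)=1$, $\mu(a)=0$ iff $a=\mathbf 0$, and $\mu\big(\bigvee_{n<\omega} a_n\big)=\sum_{n<\omega}\mu(a_n)$ whenever the $a_n\in\mathbb{B}$ are pairwise disjoint. Then $\mathbb{B}$ is $\mathbf{Ue}$-good. Moreover, $H$ can be taken to be a singleton: for every $\mathbb{B}$-name $\dot y$ for a member of $\Omega$ there is $y\in\Omega$ in the ground model such that, for every $x\in 2^\omega$ in the ground model, if $x\notin N^*_y$ then $\Vdash_{\mathbb{B}} x\notin N^*_{\dot y}$. -/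

import Mathlib

open MeasureTheory

universe u

namespace UeGoodness

noncomputable section

/-! ### Strictly positive σ-additive measures on Boolean algebras -/

/-- `μ : B → [0,1]` is a strictly positive σ-additive (probability) measure on the complete
Boolean algebra `B`. -/
structure IsStrictlyPositiveMeasure {B : Type u} [CompleteBooleanAlgebra B] (μ : B → ℝ) :
    Prop where
  mem_Icc : ∀ a, μ a ∈ Set.Icc (0 : ℝ) 1
  map_top : μ ⊤ = 1
  hasSum_iSup : ∀ a : ℕ → B, Pairwise (fun i j => Disjoint (a i) (a j)) →
    HasSum (fun i => μ (a i)) (μ (⨆ i, a i))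
  eq_zero_iff : ∀ a, μ a = 0 ↔ a = ⊥

/-! ### The space `Ω` and the sets `N*_y` in the ground model -/

/-- The basic clopen set `[s] ⊆ 2^ω` of a finite binary sequence `s`. -/
def cyl (s : List Bool) : Set (ℕ → Bool) :=
  {x | ∀ (i : ℕ) (h : i < s.length), x i = s[i]}

/-- The clopen set `⋃_{s ∈ a} [s]` of a finite set `a` of finite binary sequences. -/
def clopen (a : Finset (List Bool)) : Set (ℕ → Bool) :=
  ⋃ s ∈ a, cyl s

/-- The Lebesgue measure on `2^ω`: the product of the uniform measures on `{0,1}`. -/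
def Lb : Measure (ℕ → Bool) :=
  Measure.infinitePi (fun _ : ℕ => (PMF.uniformOfFintype Bool).toMeasure)

/-- `Ω_n`: the finite sets `a` of finite binary sequences with `Lb (⋃_{s ∈ a} [s]) ≤ 2^{-n}`. -/
def OmegaLevel (n : ℕ) : Type :=
  {a : Finset (List Bool) // Lb (clopen a) ≤ (2 : ENNReal)⁻¹ ^ n}

/-- `Ω = ∏_n Ω_n`. -/
def Omega : Type := ∀ n, OmegaLevel n

/-- `N*_y = ⋃_n ⋂_{m ≥ n} ⋃_{s ∈ y(m)} [s]`. -/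
def NStar (y : Omega) : Set (ℕ → Bool) :=
  ⋃ n : ℕ, ⋂ m ≥ n, clopen (y m).1

/-! ### The Boolean-valued universe -/

/-- The class `V^B` of `B`-names: a name is a family of names, each with a weight in `B`. -/
inductive BName (B : Type u) : Type (u + 1)
  | mk (ι : Type u) (elt : ι → BName B) (wt : ι → B) : BName B

variable {B : Type u} [CompleteBooleanAlgebra B]

/-- The Boolean value `⟦σ = τ⟧`, that is `⟦σ ⊆ τ⟧ ⊓ ⟦τ ⊆ σ⟧`. -/
def bEq : BName B → BName B → B
  | .mk ι σ p, .mk κ τ q =>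
    (⨅ i : ι, p i ⇨ ⨆ j : κ, q j ⊓ bEq (σ i) (τ j)) ⊓
    (⨅ j : κ, q j ⇨ ⨆ i : ι, p i ⊓ bEq (σ i) (τ j))

/-- The Boolean value `⟦σ ∈ τ⟧`. -/
def bMem (σ : BName B) : BName B → B
  | .mk κ τ q => ⨆ j : κ, q j ⊓ bEq σ (τ j)

/-- The Boolean value `⟦σ ⊆ τ⟧`. -/
def bSubset : BName B → BName B → B
  | .mk ι σ p, τ => ⨅ i : ι, p i ⇨ bMem (σ i) τ

variable (B) in
/-- The canonical name `x̌` of a set `x` of the ground model. -/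
def check : PSet.{u} → BName B
  | .mk ι x => .mk ι (fun i => check (x i)) (fun _ => ⊤)

/-- A condition `p` forces a statement with Boolean value `v` when `p ≤ v`. -/
def Forces (p v : B) : Prop := p ≤ v

/-! ### Ground-model sets coding the elements of `ω × Ω_n` -/

/-- The Kuratowski ordered pair. -/
def pairSet (x y : PSet.{u}) : PSet.{u} := {{x}, {x, y}}

/-- A finite binary sequence as a function from its length to `{0,1}`, i.e. a set of pairs. -/
def seqSet (s : List Bool) : PSet.{u} :=
  .mk (ULift.{u} (Fin s.length)) fun i =>
    pairSet (PSet.ofNat i.down) (PSet.ofNat (s[i.down]).toNat)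

/-- A finite set of finite binary sequences as a set. -/
def finsetSet (a : Finset (List Bool)) : PSet.{u} :=
  .mk (ULift.{u} {s // s ∈ a}) fun s => seqSet s.down.1

/-- The ordered pair `(n, a)` as a set. -/
def pointSet (n : ℕ) (a : Finset (List Bool)) : PSet.{u} :=
  pairSet (PSet.ofNat n) (finsetSet a)

/-- The set `{(n, a) : n ∈ ω, a ∈ Ω_n}`. The elements of `Ω` are the functions with domain `ω`
that are subsets of it. -/
def graphSet : PSet.{u} :=
  .mk (ULift.{u} (Σ n : ℕ, OmegaLevel n)) fun z => pointSet z.down.1 z.down.2.1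

/-! ### Boolean values of the statements about a name for a member of `Ω`

The sets `Ω_n` consist of hereditarily finite sets and are absolute, so "`ẏ ∈ Ω`" says in the
extension that `ẏ` is a function with domain `ω` and `ẏ(n) ∈ Ω̌_n`. As usual, the Boolean value of a
quantifier bounded by a canonical name is the infimum or supremum over the ground-model set. -/

/-- The Boolean value `⟦ẏ(n) = ǎ⟧`, i.e. `⟦(n, a)ˇ ∈ ẏ⟧`. -/
def valueAt (ydot : BName B) (n : ℕ) (a : Finset (List Bool)) : B :=
  bMem (check B (pointSet n a)) ydot

/-- The Boolean value `⟦ẏ ∈ Ω⟧`: `ẏ` is a subset of `{(n, a) : a ∈ Ω_n}`, and for every `n`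
there is a unique `a ∈ Ω_n` with `(n, a) ∈ ẏ`. -/
def memOmega (ydot : BName B) : B :=
  bSubset ydot (check B graphSet) ⊓
  ⨅ n : ℕ, ⨆ a : OmegaLevel n,
    valueAt ydot n a.1 ⊓ ⨅ (b : OmegaLevel n) (_ : b ≠ a), (valueAt ydot n b.1)ᶜ

/-- The Boolean value `⟦x̌ ∈ N*_ẏ⟧` for a real `x` of the ground model:
`∃ n, ∀ m ≥ n, ∃ a ∈ Ω_m, ẏ(m) = a ∧ x ∈ ⋃_{s ∈ a} [s]`. -/
def memNStar (x : ℕ → Bool) (ydot : BName B) : B :=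
  ⨆ n : ℕ, ⨅ m ≥ n, ⨆ (a : OmegaLevel m) (_ : x ∈ clopen a.1), valueAt ydot m a.1

/-- `ẏ` is a `B`-name for a member of `Ω`. -/
def IsNameForOmega (ydot : BName B) : Prop := Forces ⊤ (memOmega ydot)

variable (B) in
/-- `B` is `θ`-`Ue`-good, for the relational system `Ue = ⟨2^ω, Ω, x ∈ N*_y⟩`: for every `B`-name
`ẏ` for a member of `Ω` there is a non-empty `H ⊆ Ω` of size `< θ` such that every `x ∈ 2^ω` that
is `Ue`-unbounded over `H` is forced to be outside `N*_ẏ`. -/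
def IsUeGood (θ : Cardinal.{0}) : Prop :=
  ∀ ydot : BName B, IsNameForOmega ydot →
    ∃ H : Set Omega, H.Nonempty ∧ Cardinal.mk H < θ ∧
      ∀ x : ℕ → Bool, (∀ y ∈ H, x ∉ NStar y) → Forces ⊤ (memNStar x ydot)ᶜ

end

end UeGoodness

namespace UeGoodness

/-! ### Strictly positive measures -/

namespace IsStrictlyPositiveMeasure

variable {B : Type u} [CompleteBooleanAlgebra B] {μ : B → ℝ}

/-! Only the even levels of `ydot` are used. The possible values of `ydot` at `2 * n` form an
antichain, so the measure of the Boolean value of "`x` lies in the clopen set coded by the value at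
`2 * n`" is a weighted sum of indicators, with integral at most `4⁻ⁿ`. By Markov it reaches `2⁻ⁿ`
only on a set of measure at most `2⁻ⁿ`; passing to a finite subsum makes this set clopen, hence
coded by some `y n` (`exists_omegaLevel_covering`). If `x ∈ N*` has nonzero Boolean value, strict
positivity bounds those measures below by a fixed positive number at all large levels, so `x` lies
in almost all `y n`. -/

lemma nonneg (hμ : IsStrictlyPositiveMeasure μ) (a : B) : 0 ≤ μ a := (hμ.mem_Icc a).1

lemma le_one (hμ : IsStrictlyPositiveMeasure μ) (a : B) : μ a ≤ 1 := (hμ.mem_Icc a).2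

lemma map_bot (hμ : IsStrictlyPositiveMeasure μ) : μ ⊥ = 0 := (hμ.eq_zero_iff ⊥).2 rfl

lemma pos (hμ : IsStrictlyPositiveMeasure μ) {a : B} (ha : a ≠ ⊥) : 0 < μ a :=
  lt_of_le_of_ne (hμ.nonneg a) fun h => ha ((hμ.eq_zero_iff a).1 h.symm)

/-- Additivity along an arbitrary countable index type. -/
lemma hasSum_iSup_of_countable (hμ : IsStrictlyPositiveMeasure μ) {ι : Type*} [Countable ι]
    (v : ι → B) (hv : Pairwise (Function.onFun Disjoint v)) :
    HasSum (fun i => μ (v i)) (μ (⨆ i, v i)) := by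
  -- Pad the family with `⊥` off the range of an injection into `ℕ`; the padding has measure `0`.
  obtain ⟨e, he⟩ := exists_injective_nat ι
  have hext : ∀ i, Function.extend e v ⊥ (e i) = v i := fun i => he.extend_apply v ⊥ i
  have hdisj : Pairwise (fun i j =>
      Disjoint (Function.extend e v ⊥ i) (Function.extend e v ⊥ j)) := by
    intro i j hij
    by_cases hi : ∃ k, e k = i
    · by_cases hj : ∃ k, e k = j
      · obtain ⟨k, rfl⟩ := hi
        obtain ⟨l, rfl⟩ := hj
        rw [hext, hext]
        exact hv fun h => hij (congrArg e h)
      · rw [Function.extend_apply' _ _ _ hj]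
        exact disjoint_bot_right
    · rw [Function.extend_apply' _ _ _ hi]
      exact disjoint_bot_left
  have hsum := hμ.hasSum_iSup _ hdisj
  rw [iSup_extend_bot he, ← he.hasSum_iff] at hsum
  · simpa only [Function.comp_def, hext] using hsum
  · rintro i hi
    rw [Function.extend_apply' _ _ _ hi]
    exact hμ.map_bot

lemma mono (hμ : IsStrictlyPositiveMeasure μ) {a b : B} (hab : a ≤ b) : μ a ≤ μ b := by
  have hdisj : Pairwise (Function.onFun Disjoint fun i : Bool => cond i a (b \ a)) := by
    rintro (_ | _) (_ | _) h
    · exact absurd rfl h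
    · exact disjoint_sdiff_self_left
    · exact disjoint_sdiff_self_right
    · exact absurd rfl h
  have h := hμ.hasSum_iSup_of_countable _ hdisj
  have hsup : ⨆ i : Bool, cond i a (b \ a) = b := by
    rw [iSup_bool_eq]
    exact sup_sdiff_cancel_right hab
  rw [hsup] at h
  exact le_hasSum h true fun i _ => hμ.nonneg _

end IsStrictlyPositiveMeasure

/-! ### Clopen subsets of the Cantor space -/

lemma measurableSet_clopen (a : Finset (List Bool)) : MeasurableSet (clopen a) := by
  refine Finset.measurableSet_biUnion _ fun s _ => ?_
  have : cyl s = ⋂ i : Fin s.length, {x | x i = s[i]} := by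
    ext x
    simp [cyl, Fin.forall_iff]
  rw [this]
  exact MeasurableSet.iInter fun i => (measurable_pi_apply (i : ℕ)) (measurableSet_singleton _)

/-- A set that depends on finitely many coordinates is a finite union of basic clopen sets. -/
lemma exists_clopen_eq {S : Set (ℕ → Bool)} (L : ℕ)
    (hS : ∀ x y : ℕ → Bool, (∀ i < L, x i = y i) → x ∈ S → y ∈ S) :
    ∃ b, clopen b = S := by
  classical
  -- The padding value `false` is irrelevant, since `S` sees only the first `L` coordinates.
  let ext (f : Fin L → Bool) : ℕ → Bool := fun i => if h : i < L then f ⟨i, h⟩ else false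
  have hcyl : ∀ (f : Fin L → Bool) (x : ℕ → Bool),
      x ∈ cyl (List.ofFn f) ↔ ∀ i < L, x i = ext f i := by
    intro f x
    simp only [cyl, Set.mem_ofPred_eq, List.length_ofFn, List.getElem_ofFn, ext]
    exact forall₂_congr fun i hi => by rw [dif_pos hi]
  refine ⟨(Finset.univ.filter fun f : Fin L → Bool => ext f ∈ S).image List.ofFn, ?_⟩
  ext x
  simp only [clopen, Finset.mem_image, Finset.mem_filter, Finset.mem_univ, true_and,
    Set.mem_iUnion, exists_prop]
  constructor
  · rintro ⟨_, ⟨f, hf, rfl⟩, hx⟩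
    exact hS _ _ (fun i hi => ((hcyl f x).1 hx i hi).symm) hf
  · intro hx
    have hext : ∀ i < L, x i = ext (fun j => x j) i := fun i hi => by simp [ext, hi]
    exact ⟨_, ⟨fun j => x j, hS _ _ hext hx, rfl⟩, (hcyl _ x).2 hext⟩

lemma mem_clopen_congr {a : Finset (List Bool)} {L : ℕ} (ha : ∀ s ∈ a, s.length ≤ L)
    {x y : ℕ → Bool} (hxy : ∀ i < L, x i = y i) : x ∈ clopen a ↔ y ∈ clopen a := by
  simp only [clopen, Set.mem_iUnion, exists_prop, cyl, Set.mem_ofPred_eq]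
  refine exists_congr fun s => and_congr_right fun hs => forall₂_congr fun i hi => ?_
  rw [hxy i (hi.trans_le (ha s hs))]

lemma exists_length_le {ι : Type*} (F : Finset ι) (c : ι → Finset (List Bool)) :
    ∃ L, ∀ i ∈ F, ∀ s ∈ c i, s.length ≤ L :=
  ⟨F.sup fun i => (c i).sup List.length, fun _ hi _ hs =>
    (Finset.le_sup (f := List.length) hs).trans
      (Finset.le_sup (f := fun i => (c i).sup List.length) hi)⟩

/-- Markov's inequality for a finite weighted family of sets of small measure. -/
lemma mul_measure_le_sum_indicator_le {α ι : Type*} [MeasurableSpace α] (ν : Measure α)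
    (F : Finset ι) (A : ι → Set α) (hA : ∀ i, MeasurableSet (A i)) (w : ι → ENNReal)
    (hw : ∑ i ∈ F, w i ≤ 1) {ε : ENNReal} (hε : ∀ i, ν (A i) ≤ ε) (t : ENNReal) :
    t * ν {x | t ≤ ∑ i ∈ F, (A i).indicator (fun _ => w i) x} ≤ ε := by
  have hm : ∀ i ∈ F, Measurable ((A i).indicator fun _ => w i) :=
    fun i _ => measurable_const.indicator (hA i)
  calc t * ν {x | t ≤ ∑ i ∈ F, (A i).indicator (fun _ => w i) x}
      ≤ ∫⁻ x, ∑ i ∈ F, (A i).indicator (fun _ => w i) x ∂ν :=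
        mul_meas_ge_le_lintegral (Finset.measurable_fun_sum F hm) t
    _ = ∑ i ∈ F, w i * ν (A i) := by
        rw [lintegral_finsetSum F hm]
        exact Finset.sum_congr rfl fun i _ => lintegral_indicator_const (hA i) _
    _ ≤ ∑ i ∈ F, w i * ε := Finset.sum_le_sum fun i _ => mul_le_mul_right (hε i) _
    _ = (∑ i ∈ F, w i) * ε := (Finset.sum_mul ..).symm
    _ ≤ ε := mul_le_of_le_one_left' hw

instance (n : ℕ) : Countable (OmegaLevel n) :=
  inferInstanceAs (Countable {a : Finset (List Bool) // Lb (clopen a) ≤ (2 : ENNReal)⁻¹ ^ n})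

/-! ### Capturing a name by a member of `Ω` -/

variable {B : Type u} [CompleteBooleanAlgebra B] {μ : B → ℝ}

/-- Given an antichain indexed by `Ω_{2n}`, some member of `Ω_n` covers all reals `x` for which
the join of the elements indexed by sets containing `x` has measure at least `2 * 2⁻ⁿ`. -/
lemma exists_omegaLevel_covering (hμ : IsStrictlyPositiveMeasure μ) (n : ℕ)
    (v : OmegaLevel (2 * n) → B) (hv : Pairwise (Function.onFun Disjoint v)) :
    ∃ b : OmegaLevel n, ∀ x : ℕ → Bool,
      2 * (2⁻¹ : ℝ) ^ n ≤ μ (⨆ (a : OmegaLevel (2 * n)) (_ : x ∈ clopen a.1), v a) →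
        x ∈ clopen b.1 := by
  classical
  have hsum := hμ.hasSum_iSup_of_countable v hv
  have hpos : (0 : ℝ) < 2⁻¹ ^ n := by positivity
  -- The discarded tail weighs less than `2⁻ⁿ`, which is why the threshold for `x` is `2 * 2⁻ⁿ`
  -- while Markov is applied at `2⁻ⁿ`.
  obtain ⟨F, hF⟩ : ∃ F : Finset (OmegaLevel (2 * n)),
      μ (⨆ a, v a) - 2⁻¹ ^ n < ∑ a ∈ F, μ (v a) :=
    (hsum.eventually_const_lt (sub_lt_self _ hpos)).exists
  have hF1 : ∑ a ∈ F, μ (v a) ≤ 1 :=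
    (sum_le_hasSum F (fun _ _ => hμ.nonneg _) hsum).trans (hμ.le_one _)
  let f (x : ℕ → Bool) : ENNReal :=
    ∑ a ∈ F, (clopen a.1).indicator (fun _ => ENNReal.ofReal (μ (v a))) x
  obtain ⟨L, hL⟩ := exists_length_le F fun a : OmegaLevel (2 * n) => a.1
  obtain ⟨b, hb⟩ := exists_clopen_eq (S := {x | (2⁻¹ : ENNReal) ^ n ≤ f x}) L (by
    intro x y hxy hx
    have : f x = f y := Finset.sum_congr rfl fun a ha => by
      simp only [Set.indicator_apply, mem_clopen_congr (hL a ha) hxy]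
    simpa only [Set.mem_ofPred_eq, this] using hx)
  have hmarkov : (2⁻¹ : ENNReal) ^ n * Lb (clopen b) ≤ 2⁻¹ ^ (2 * n) := by
    rw [hb]
    refine mul_measure_le_sum_indicator_le Lb F (fun a => clopen a.1)
      (fun a => measurableSet_clopen a.1) _ ?_ (fun a => a.2) _
    rw [← ENNReal.ofReal_sum_of_nonneg fun a _ => hμ.nonneg _]
    exact ENNReal.ofReal_le_one.2 hF1
  -- Starting from level `2 * n` leaves a factor `2⁻ⁿ` to cancel.
  have hLb : Lb (clopen b) ≤ (2 : ENNReal)⁻¹ ^ n := by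
    rw [two_mul, pow_add] at hmarkov
    exact (ENNReal.mul_le_mul_iff_right (by simp) (by simp)).1 hmarkov
  refine ⟨⟨b, hLb⟩, fun x hx => ?_⟩
  let v' (a : OmegaLevel (2 * n)) : B := ⨆ _ : x ∈ clopen a.1, v a
  have hle : ∀ a, v' a ≤ v a := fun a => iSup_le fun _ => le_rfl
  have hsum' := hμ.hasSum_iSup_of_countable v' fun a a' h => (hv h).mono (hle a) (hle a')
  -- As `v' ≤ v`, restricting to `F` costs `v'` no more than it costs `v`.
  have htail := sum_le_hasSum F (fun a _ => sub_nonneg.2 (hμ.mono (hle a))) (hsum.sub hsum')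
  rw [Finset.sum_sub_distrib] at htail
  have hfin : (2⁻¹ : ℝ) ^ n ≤ ∑ a ∈ F, μ (v' a) := by
    have hx' : 2 * (2⁻¹ : ℝ) ^ n ≤ μ (⨆ a, v' a) := hx
    linarith
  change x ∈ clopen b
  rw [hb]
  have hf : f x = ENNReal.ofReal (∑ a ∈ F, μ (v' a)) := by
    rw [ENNReal.ofReal_sum_of_nonneg fun a _ => hμ.nonneg _]
    refine Finset.sum_congr rfl fun a _ => ?_
    by_cases h : x ∈ clopen a.1 <;> simp [v', h, hμ.map_bot]
  have hpow : ENNReal.ofReal ((2⁻¹ : ℝ) ^ n) = (2⁻¹ : ENNReal) ^ n := by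
    rw [ENNReal.ofReal_pow (by norm_num), ENNReal.ofReal_inv_of_pos (by norm_num),
      ENNReal.ofReal_ofNat]
  rw [Set.mem_ofPred_eq, hf, ← hpow]
  exact ENNReal.ofReal_le_ofReal hfin

/-- The values of a name for a member of `Ω` at a fixed `n` form an antichain. -/
lemma IsNameForOmega.pairwise_disjoint_valueAt {ydot : BName B} (h : IsNameForOmega ydot) (n : ℕ) :
    Pairwise (Function.onFun Disjoint fun a : OmegaLevel n => valueAt ydot n a.1) := by
  have hsup := (h.trans inf_le_right).trans (iInf_le _ n)
  have key : ∀ a : OmegaLevel n, valueAt ydot n a.1 ≤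
      ⨅ (b : OmegaLevel n) (_ : b ≠ a), (valueAt ydot n b.1)ᶜ := by
    intro a
    -- Split over the unique value `c`: if `c ≠ a`, its uniqueness clause contradicts the value
    -- being `a`.
    refine (le_inf le_rfl (le_top.trans hsup)).trans ?_
    rw [inf_iSup_eq]
    refine iSup_le fun c => ?_
    by_cases hca : a = c
    · subst hca
      exact inf_le_right.trans inf_le_right
    · have hc : (⨅ (b : OmegaLevel n) (_ : b ≠ c), (valueAt ydot n b.1)ᶜ) ≤
          (valueAt ydot n a.1)ᶜ := iInf₂_le a hca
      calc _ ≤ valueAt ydot n a.1 ⊓ (valueAt ydot n a.1)ᶜ :=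
            inf_le_inf_left _ (inf_le_right.trans hc)
        _ = ⊥ := inf_compl_self _
        _ ≤ _ := bot_le
  intro a b hab
  exact (le_compl_iff_disjoint_right.1 ((key a).trans (iInf₂_le b hab.symm)))

/-- Every name for a member of `Ω` is dominated by a single member of `Ω` in the ground model. -/
theorem IsStrictlyPositiveMeasure.exists_omega_dominating (hμ : IsStrictlyPositiveMeasure μ)
    {ydot : BName B} (hy : IsNameForOmega ydot) :
    ∃ y : Omega, ∀ x : ℕ → Bool, x ∉ NStar y → Forces ⊤ (memNStar x ydot)ᶜ := by
  choose y hcover using fun n => exists_omegaLevel_covering hμ n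
    (fun a => valueAt ydot (2 * n) a.1) (hy.pairwise_disjoint_valueAt (2 * n))
  refine ⟨y, fun x hx => ?_⟩
  contrapose! hx
  have hne : memNStar x ydot ≠ ⊥ := fun h => hx (by simp [Forces, h])
  obtain ⟨k, hk⟩ : ∃ k : ℕ, (⨅ m ≥ k, ⨆ (a : OmegaLevel m) (_ : x ∈ clopen a.1),
      valueAt ydot m a.1) ≠ ⊥ := by
    by_contra! h
    exact hne (by simp only [memNStar, h, iSup_bot])
  -- Halving the measure absorbs the factor `2` in the covering threshold.
  obtain ⟨N, hN⟩ := exists_pow_lt_of_lt_one (half_pos (hμ.pos hk)) (by norm_num : (2⁻¹ : ℝ) < 1)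
  refine Set.mem_iUnion.2 ⟨max k N, Set.mem_iInter₂.2 fun m hm => hcover m x ?_⟩
  have hkm : k ≤ m := (le_max_left k N).trans hm
  have hNm : N ≤ m := (le_max_right k N).trans hm
  have hpow : (2⁻¹ : ℝ) ^ m ≤ 2⁻¹ ^ N := pow_le_pow_of_le_one (by norm_num) (by norm_num) hNm
  have hmono := hμ.mono (iInf₂_le (f := fun m (_ : m ≥ k) =>
    ⨆ (a : OmegaLevel m) (_ : x ∈ clopen a.1), valueAt ydot m a.1) (2 * m) (by omega))
  linarith

end UeGoodness

theorem lemma5p3 {B : Type*} [CompleteBooleanAlgebra B] (μ : B → ℝ)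
    (hμ : UeGoodness.IsStrictlyPositiveMeasure μ) :
    UeGoodness.IsUeGood B (Cardinal.aleph 1) ∧
    ∀ ydot : UeGoodness.BName B, UeGoodness.IsNameForOmega ydot →
      ∃ y : UeGoodness.Omega, ∀ x : ℕ → Bool, x ∉ UeGoodness.NStar y →
        UeGoodness.Forces ⊤ (UeGoodness.memNStar x ydot)ᶜ := by
  refine ⟨fun ydot hy => ?_, fun ydot hy => hμ.exists_omega_dominating hy⟩
  obtain ⟨y, h⟩ := hμ.exists_omega_dominating hy
  refine ⟨{y}, Set.singleton_nonempty y, ?_, fun x hx => h x (hx y rfl)⟩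
  rw [Cardinal.mk_singleton]
  exact Cardinal.one_lt_aleph0.trans_le (Cardinal.aleph0_le_aleph 1)
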